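/- An electricity division instance with $n$ households consists of a supply $S>0$, demands $D[1],\dots,D[n]>0$ with $D[i]\le S$ for every $i$, and a time interval $[0,T]$ with $T>0$. A schedule is a partition of $[0,T]$ into finitely many subintervals $I_1,\dots,I_p$ together with sets $A_1,\dots,A_p\subseteq\{1,\dots,n\}$ such that $\sum_{i\in A_l}D[i]\le S$ for every $l$; household $i$ is then connected for the time $u_i=\sum_{l:\,i\in A_l}|I_l|$. The egalitarian connection time of the instance is the maximum over all schedules of $\min_i u_i$. For an integer $k\ge 1$, a $k$-times bin packing is a finite sequence of subsets (bins) of $\{1,\dots,n\}$, each of total demand at most $S$, such that every $i$ lies in exactly $k$ bins; $OPT(D_k)$ denotes the least possible number of bins. Let $K(D)$ be the smallest integer $k\ge 1$ such that the egalitarian connection time equals $\frac{k}{OPT(D_k)}\,T$, and let $K(n)$ be the maximum of $K(D)$ over all instances with $n$ households. **Proposition.** $K(6)=9$ (in particular, $K(D)$ exists for every instance with $6$ households). Moreover, the maximum is attained by the instances with $S=9$ and $D=[4,2,5,3,2,1]$: for these, $K(D)=9$ and $OPT(D_9)=17$, and there is a $9$-times bin packing into $17$ bins each of total demand exactly $9$.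 -/

import Mathlib

open Finset

/-- An instance of the electricity division problem with `n` households: a supply `S > 0`, positive
demands `D i`, and a time interval `[0, T]`. No single demand exceeds the supply, since otherwise
that household could never be connected and no bin could contain it. -/
structure ElectricityInstance (n : ℕ) where
  S : ℝ
  D : Fin n → ℝ
  T : ℝ
  S_pos : 0 < S
  D_pos : ∀ i, 0 < D i
  D_le : ∀ i, D i ≤ S
  T_pos : 0 < T

namespace ElectricityInstance

variable {n : ℕ}

/-- A set of households can be connected simultaneously (equivalently: fits into one bin of
capacity `S`). -/
def Feasible (I : ElectricityInstance n) (A : Finset (Fin n)) : Prop :=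
  ∑ i ∈ A, I.D i ≤ I.S

/-- A schedule: a partition `0 = t 0 < t 1 < ⋯ < t p = T` of `[0, T]` into `p` subintervals, and
for each subinterval `l` the set `A l` of households connected during it. -/
structure Schedule (I : ElectricityInstance n) where
  p : ℕ
  t : Fin (p + 1) → ℝ
  t_strictMono : StrictMono t
  t_zero : t 0 = 0
  t_last : t (Fin.last p) = I.T
  A : Fin p → Finset (Fin n)
  feasible : ∀ l, I.Feasible (A l)

/-- The total time during which household `i` is connected. -/
def Schedule.utility {I : ElectricityInstance n} (s : I.Schedule) (i : Fin n) : ℝ :=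
  ∑ l : Fin s.p with i ∈ s.A l, (s.t l.succ - s.t l.castSucc)

/-- `r` is the egalitarian connection time of the instance: the maximum over all schedules of the
minimum over all households of the connection time. -/
def IsEgalitarianTime (I : ElectricityInstance n) (r : ℝ) : Prop :=
  IsGreatest (Set.range fun s : I.Schedule => ⨅ i, s.utility i) r

/-- `B` is a valid `k`-times bin packing with `q` bins: no bin exceeds the capacity, and every item
lies in exactly `k` of the bins (a bin is a set, so it holds an item at most once). -/
def IsPacking (I : ElectricityInstance n) (k : ℕ) {q : ℕ} (B : Fin q → Finset (Fin n)) : Prop :=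
  (∀ j, I.Feasible (B j)) ∧ ∀ i, #{j | i ∈ B j} = k

/-- The optimal (least) number of bins in a `k`-times bin packing. -/
noncomputable def opt (I : ElectricityInstance n) (k : ℕ) : ℕ :=
  sInf {q : ℕ | ∃ B : Fin q → Finset (Fin n), I.IsPacking k B}

/-- A `k`-times bin packing always exists, so that `opt` is a genuine minimum. -/
theorem exists_packing (I : ElectricityInstance n) (k : ℕ) :
    {q : ℕ | ∃ B : Fin q → Finset (Fin n), I.IsPacking k B}.Nonempty := by
  refine ⟨n * k, fun j => {(finProdFinEquiv.symm j).1}, fun j => ?_, fun i => ?_⟩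
  · simpa [Feasible] using I.D_le _
  · have h : #(({i} : Finset (Fin n)) ×ˢ (univ : Finset (Fin k))) = k := by
      rw [card_product, card_singleton, card_univ, Fintype.card_fin, one_mul]
    refine Eq.trans (card_bij (fun j _ => finProdFinEquiv.symm j) ?_ ?_ ?_) h
    · intro a ha
      rw [mem_filter, mem_singleton] at ha
      rw [mem_product, mem_singleton]
      exact ⟨ha.2.symm, mem_univ _⟩
    · intro a _ b _ hab
      exact finProdFinEquiv.symm.injective hab
    · intro b hb
      rw [mem_product, mem_singleton] at hb
      refine ⟨finProdFinEquiv b, ?_, Equiv.symm_apply_apply _ _⟩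
      rw [mem_filter, mem_singleton, Equiv.symm_apply_apply]
      exact ⟨mem_univ _, hb.1.symm⟩

/-- `k`-times bin packing (`k ≥ 1`) yields the optimal electricity division: connecting each bin of
an optimal packing for a fraction `1 / opt k` of the time gives every household the fraction
`k / opt k` of the time `T`, and this is the egalitarian connection time. -/
def IsSolvedBy (I : ElectricityInstance n) (k : ℕ) : Prop :=
  1 ≤ k ∧ I.IsEgalitarianTime ((k : ℝ) / (I.opt k : ℝ) * I.T)

/-- The smallest `k` such that `k`-times bin packing yields the optimal electricity division
(`⊤` if there were no such `k`). -/
noncomputable def leastK (I : ElectricityInstance n) : ℕ∞ :=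
  ⨅ (k : ℕ) (_ : I.IsSolvedBy k), (k : ℕ∞)

end ElectricityInstance

/-- The maximum of `leastK` over all instances with `n` households. The supremum is taken in `ℕ∞`,
so a finite positive value of it means that every `leastK` is finite and that it is attained. -/
noncomputable def maxLeastK (n : ℕ) : ℕ∞ :=
  ⨆ I : ElectricityInstance n, I.leastK

/-!
Up to scaling, a schedule is a fractional cover of the households by bins. An optimal cover may be
taken to be a basic solution of the covering program, so by Cramer's rule it has a common
denominator `k` which is the absolute value of the determinant of a `0`-`1` matrix of order `n`;
clearing denominators gives a `k`-times bin packing at least as good as the schedule. Hence `K(D)`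
is at most the largest determinant of a `0`-`1` matrix of order `n`.

For `n = 6` this is at most `9`. Bordering a `0`-`1` matrix `M` of order `6` gives a sign matrix `R`
of order `7` with `|det R| = 64 |det M|`, so it suffices that `det (R Rᵀ) < 640² = 409600`. After
changing the signs of rows, the off-diagonal entries of `R Rᵀ` are `3` modulo `4`. If one of them is
`-5` or `7`, or if being different from `-1` is not transitive, then Fischer's inequality for a
principal minor of order `2` or `3` gives the bound; otherwise `R Rᵀ` is one of Ehlich's block
matrices, whose determinants are explicit.

Conversely, the demands `4, 2, 5, 3, 2, 1` add up to `17`, so `17 k ≤ 9 OPT(D_k)`, with equality for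
`k = 9`. Any `k` solving the instance must also attain equality and is therefore divisible by `9`.
-/

section DeterminantInequalities

open Matrix
open scoped ComplexOrder

variable {𝕜 ι κ κ' : Type*} [RCLike 𝕜] [Fintype ι] [DecidableEq ι] [Fintype κ] [DecidableEq κ]
  [Fintype κ'] [DecidableEq κ']

theorem det_le_one_of_posSemidef_of_trace_le_card {W : Matrix ι ι 𝕜} (hW : W.PosSemidef)
    (htr : W.trace ≤ Fintype.card ι) : W.det ≤ 1 := by
  set eig := hW.isHermitian.eigenvalues
  have hsum : ∑ i, eig i ≤ Fintype.card ι := by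
    rw [hW.isHermitian.trace_eq_sum_eigenvalues] at htr
    exact_mod_cast htr
  suffices h : ∏ i, eig i ≤ 1 by
    rw [hW.isHermitian.det_eq_prod_eigenvalues]
    exact_mod_cast h
  calc ∏ i, eig i ≤ ∏ i, Real.exp (eig i - 1) :=
        prod_le_prod (fun i _ => hW.eigenvalues_nonneg i) fun i _ => by
          simpa using Real.add_one_le_exp (eig i - 1)
    _ = Real.exp (∑ i, (eig i - 1)) := (Real.exp_sum _ _).symm
    _ ≤ 1 := Real.exp_le_one_iff.2 (by simpa using hsum)

theorem det_le_det_of_trace_inv_mul_le_card {G Q : Matrix ι ι 𝕜} (hG : G.PosSemidef)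
    (hQ : Q.PosDef) (htr : (Q⁻¹ * G).trace ≤ Fintype.card ι) : G.det ≤ Q.det := by
  open scoped MatrixOrder in
  obtain ⟨B, hB⟩ := CStarAlgebra.nonneg_iff_eq_star_mul_self.mp hQ.posSemidef.nonneg
  rw [star_eq_conjTranspose] at hB
  have hBdet : IsUnit B.det := by
    refine isUnit_of_mul_isUnit_right (x := Bᴴ.det) ?_
    rw [← det_mul, ← hB]
    exact hQ.det_pos.ne'.isUnit
  set W := (B⁻¹)ᴴ * G * B⁻¹ with hW
  have hWdet : W.det ≤ 1 := by
    refine det_le_one_of_posSemidef_of_trace_le_card (hG.conjTranspose_mul_mul_same B⁻¹) ?_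
    rwa [hW, trace_mul_comm, ← Matrix.mul_assoc, conjTranspose_nonsing_inv, ← Matrix.mul_inv_rev,
      ← hB]
  have hGW : G = Bᴴ * W * B := by
    have hBH : IsUnit Bᴴ.det := by simpa [det_conjTranspose] using hBdet
    rw [hW, conjTranspose_nonsing_inv, Matrix.mul_assoc, Matrix.mul_assoc, Matrix.mul_assoc,
      nonsing_inv_mul _ hBdet, Matrix.mul_one, mul_nonsing_inv_cancel_left _ _ hBH]
  clear_value W
  calc G.det = W.det * Q.det := by rw [hGW, hB, det_mul, det_mul, det_mul]; ring
    _ ≤ Q.det := mul_le_of_le_one_left hQ.det_pos.le hWdet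

theorem hadamard_det_le_prod_diag {G : Matrix ι ι 𝕜} (hG : G.PosSemidef) :
    G.det ≤ ∏ i, G i i := by
  by_cases h0 : G.det = 0
  · exact h0 ▸ prod_nonneg fun i _ => hG.diag_nonneg
  have hdiag : ∀ i, 0 < G i i := fun i => (hG.posDef_iff_det_ne_zero.2 h0).diag_pos
  rw [← det_diagonal]
  have hinv : (diagonal fun i => G i i)⁻¹ = diagonal fun i => (G i i)⁻¹ :=
    inv_eq_right_inv (by simp [diagonal_mul_diagonal, (hdiag _).ne'])
  refine det_le_det_of_trace_inv_mul_le_card hG (posDef_diagonal_iff.2 hdiag) (le_of_eq ?_)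
  simp [hinv, Matrix.trace, (hdiag _).ne']

theorem fischer_det_fromBlocks_le {A : Matrix κ κ 𝕜} {B : Matrix κ κ' 𝕜} {C : Matrix κ' κ 𝕜}
    {D : Matrix κ' κ' 𝕜} (h : (fromBlocks A B C D).PosSemidef) :
    (fromBlocks A B C D).det ≤ A.det * D.det := by
  have hA : A.PosSemidef := h.submatrix Sum.inl
  have hD : D.PosSemidef := h.submatrix Sum.inr
  by_cases h0 : (fromBlocks A B C D).det = 0
  · exact h0 ▸ mul_nonneg hA.det_nonneg hD.det_nonneg
  have hpos := h.posDef_iff_det_ne_zero.2 h0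
  have hA' : A.PosDef := hpos.submatrix Sum.inl_injective
  have hD' : D.PosDef := hpos.submatrix Sum.inr_injective
  have hAu : IsUnit A.det := hA'.det_pos.ne'.isUnit
  have hDu : IsUnit D.det := hD'.det_pos.ne'.isUnit
  have hdet : (fromBlocks A 0 0 D).det = A.det * D.det := det_fromBlocks_zero₂₁ _ _ _
  have hQ : (fromBlocks A 0 0 D).PosDef := by
    have := invertibleOfIsUnitDet A hAu
    have hQ' : (fromBlocks A 0 0 D).PosSemidef := by
      simpa using (hA'.fromBlocks₁₁ (0 : Matrix κ κ' 𝕜) D).2 (by simpa using hD)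
    exact hQ'.posDef_iff_det_ne_zero.2 (hdet ▸ mul_ne_zero hAu.ne_zero hDu.ne_zero)
  rw [← hdet]
  refine det_le_det_of_trace_inv_mul_le_card h hQ (le_of_eq ?_)
  rw [inv_fromBlocks_zero₂₁_of_isUnit_iff _ _ _
    (iff_of_true ((isUnit_iff_isUnit_det A).2 hAu) ((isUnit_iff_isUnit_det D).2 hDu)),
    fromBlocks_multiply]
  simp [nonsing_inv_mul _ hAu, nonsing_inv_mul _ hDu, Matrix.trace]

theorem fischer_det_le_det_submatrix_mul {G : Matrix ι ι 𝕜} (hG : G.PosSemidef) {f : κ → ι}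
    (hf : Function.Injective f) :
    G.det ≤ (G.submatrix f f).det *
      (G.submatrix ((↑) : ↥(univ.image f)ᶜ → ι) (↑)).det := by
  have hinj : Function.Injective (Sum.elim f ((↑) : ↥(univ.image f)ᶜ → ι)) :=
    hf.sumElim Subtype.val_injective fun k i h => by simpa [← h] using i.2
  have hsurj : Function.Surjective (Sum.elim f ((↑) : ↥(univ.image f)ᶜ → ι)) := fun i => by
    by_cases hi : i ∈ univ.image f
    · obtain ⟨k, -, rfl⟩ := mem_image.1 hi
      exact ⟨Sum.inl k, rfl⟩
    · exact ⟨Sum.inr ⟨i, mem_compl.2 hi⟩, rfl⟩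
  rw [← det_submatrix_equiv_self (Equiv.ofBijective _ ⟨hinj, hsurj⟩) G, ← fromBlocks_toBlocks
    (G.submatrix _ _)]
  exact fischer_det_fromBlocks_le (by rw [fromBlocks_toBlocks]; exact hG.submatrix _)

end DeterminantInequalities

section ClassMatrix

open Matrix

variable {ι κ K : Type*} [Fintype ι] [DecidableEq ι] [Fintype κ] [DecidableEq κ]

/-- The matrix with entries `a + b + c` on the diagonal, `b + c` between distinct indices of the
same class `f i = f j`, and `c` between indices of different classes. Ehlich's block matrices are
the case `c = -1`. -/
def classMatrix [AddMonoid K] (a b c : K) (f : ι → κ) : Matrix ι ι K :=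
  of fun i j => (if i = j then a else 0) + (if f i = f j then b else 0) + c

theorem det_diagonal_add_replicateCol_mul_replicateRow [Field K] {d : κ → K} (hd : ∀ k, d k ≠ 0)
    (u v : κ → K) :
    (diagonal d + replicateCol Unit u * replicateRow Unit v).det =
      (∏ k, d k) * (1 + ∑ k, v k * u k / d k) := by
  have hinv : (diagonal d)⁻¹ = diagonal fun k => (d k)⁻¹ :=
    inv_eq_right_inv (by simp only [diagonal_mul_diagonal, mul_inv_cancel₀ (hd _), diagonal_one])
  have hdet : IsUnit (diagonal d).det := by
    rw [det_diagonal]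
    exact (prod_ne_zero_iff.2 fun k _ => hd k).isUnit
  rw [det_add_replicateCol_mul_replicateRow hdet, det_diagonal, hinv, det_unique, Matrix.add_apply,
    one_apply_eq, mul_apply]
  simp only [mul_diagonal, replicateRow_apply, replicateCol_apply, mul_right_comm _ _⁻¹,
    div_eq_mul_inv]

theorem det_classMatrix [Field K] {a b : K} (c : K) (f : ι → κ) (ha : a ≠ 0)
    (hab : ∀ k, 1 + b / a * #{i | f i = k} ≠ 0) :
    (classMatrix a b c f).det = a ^ Fintype.card ι * ((∏ k, (1 + b / a * #{i | f i = k})) *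
      (1 + ∑ k, c / a * #{i | f i = k} / (1 + b / a * #{i | f i = k}))) := by
  set r : κ → K := fun k => #{i | f i = k}
  set d : κ → K := fun k => 1 + b / a * r k
  set Z : Matrix ι κ K := of fun i k => if f i = k then 1 else 0
  set W : Matrix κ ι K := of fun k i => (if k = f i then b / a else 0) + c / a
  have hfactor : classMatrix a b c f = a • (1 + Z * W) := by
    ext i j
    have hZW : (Z * W) i j = W (f i) j := by simp [Z, mul_apply]
    rw [Matrix.smul_apply, Matrix.add_apply, hZW, one_apply]
    simp only [classMatrix, W, of_apply, smul_eq_mul]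
    split_ifs <;> field_simp <;> ring
  have hswap : 1 + W * Z =
      diagonal d + replicateCol Unit (fun _ => (1 : K)) *
        replicateRow Unit fun k => c / a * r k := by
    ext k l
    have hWZ : (W * Z) k l = r l * ((if k = l then b / a else 0) + c / a) := by
      calc (W * Z) k l = ∑ i with f i = l, W k i := by simp [Z, mul_apply, sum_filter]
        _ = ∑ i with f i = l, ((if k = l then b / a else 0) + c / a) :=
          sum_congr rfl fun i hi => by rw [← (mem_filter.1 hi).2]; rfl
        _ = _ := by simp [r, mul_add]
    rw [Matrix.add_apply, Matrix.add_apply, hWZ, one_apply, diagonal_apply]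
    simp only [mul_apply, replicateCol_apply, replicateRow_apply, univ_unique, sum_const,
      card_singleton, one_smul, one_mul, d]
    split_ifs with h
    · subst h; ring
    · ring
  rw [hfactor, det_smul, det_one_add_mul_comm, hswap,
    det_diagonal_add_replicateCol_mul_replicateRow hab]
  simp only [mul_one, d, r]

theorem one_add_le_pow_mul_exp (r : ℕ) :
    (1 + r : ℝ) ≤ (5 / 4) ^ r * Real.exp (r / (1 + r)) := by
  have taylor : ∀ {x : ℝ}, 0 ≤ x → 1 + x + x ^ 2 / 2 + x ^ 3 / 6 ≤ Real.exp x := fun hx => by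
    simpa [Finset.sum_range_succ, Nat.factorial] using Real.sum_le_exp_of_nonneg hx 4
  rcases lt_or_ge r 3 with h | h
  · have := taylor (x := r / (1 + r)) (by positivity)
    interval_cases r <;> norm_num at this ⊢ <;> linarith
  induction r, h using Nat.le_induction with
  | base =>
    have := taylor (x := 3 / (1 + 3)) (by positivity)
    norm_num at this ⊢
    linarith
  | succ r hr ih =>
    have hr' : (3 : ℝ) ≤ r := by exact_mod_cast hr
    have hmono : (r : ℝ) / (1 + r) ≤ ↑(r + 1) / (1 + ↑(r + 1)) := by
      push_cast
      rw [div_le_div_iff₀ (by positivity) (by positivity)]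
      nlinarith
    calc (1 + ↑(r + 1) : ℝ) ≤ 5 / 4 * (1 + r) := by push_cast; linarith
      _ ≤ 5 / 4 * ((5 / 4) ^ r * Real.exp (r / (1 + r))) := by gcongr
      _ = (5 / 4) ^ (r + 1) * Real.exp (r / (1 + r)) := by ring
      _ ≤ _ := by gcongr

theorem det_classMatrix_neg_one_le {κ : Type*} [Finite κ] [DecidableEq κ] (f : ι → κ) :
    (classMatrix (4 : ℝ) 4 (-1) f).det ≤
      4 ^ Fintype.card ι * (Real.exp 3 / 4 * (5 / 4) ^ Fintype.card ι) := by
  cases nonempty_fintype κ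
  obtain ⟨r, hr⟩ : ∃ r : κ → ℕ, ∀ k, #{i | f i = k} = r k := ⟨_, fun _ => rfl⟩
  have hcard : ∑ k, r k = Fintype.card ι := by
    simp only [← hr]
    exact (card_eq_sum_card_fiberwise fun i _ => mem_univ (f i)).symm
  -- The factor `exp y` in the bound for the product cancels against `exp (3 - y)` in `hlast`.
  set y : ℝ := ∑ k, (r k : ℝ) / (1 + r k) with hy
  have hprod : ∏ k, (1 + r k : ℝ) ≤ (5 / 4) ^ Fintype.card ι * Real.exp y :=
    calc ∏ k, (1 + r k : ℝ) ≤ ∏ k, ((5 / 4) ^ r k * Real.exp (r k / (1 + r k))) :=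
          prod_le_prod (fun _ _ => by positivity) fun k _ => one_add_le_pow_mul_exp (r k)
      _ = _ := by rw [prod_mul_distrib, prod_pow_eq_pow_sum, hcard, Real.exp_sum]
  have hlast : 1 - y / 4 ≤ Real.exp (3 - y) / 4 := by
    linarith [Real.add_one_le_exp (3 - y)]
  have hsum : ∑ k, (-1 / 4 : ℝ) * r k / (1 + r k) = -(y / 4) := by
    rw [hy, sum_div, ← sum_neg_distrib]
    exact sum_congr rfl fun k _ => by ring
  have hdet : (classMatrix (4 : ℝ) 4 (-1) f).det =
      4 ^ Fintype.card ι * ((∏ k, (1 + r k : ℝ)) * (1 - y / 4)) := by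
    rw [det_classMatrix _ _ four_ne_zero fun k => by positivity]
    simp only [hr, div_self (four_ne_zero (α := ℝ)), one_mul, hsum, sub_eq_add_neg]
  calc _ = _ := hdet
    _ ≤ 4 ^ Fintype.card ι * ((∏ k, (1 + r k : ℝ)) * (Real.exp (3 - y) / 4)) := by gcongr
    _ ≤ 4 ^ Fintype.card ι * ((5 / 4) ^ Fintype.card ι * Real.exp y * (Real.exp (3 - y) / 4)) := by
        gcongr
    _ = _ := by rw [Real.exp_sub]; field_simp

end ClassMatrix

section EhlichMatrix

open Matrix

/-- The properties of the Gram matrix `R Rᵀ` of a sign matrix `R` of order 7 whose row sums are all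
`1` modulo `4` (distinct rows then have scalar product `3` modulo `4`), together with all its
principal submatrices. -/
structure IsEhlichMatrix {ι : Type*} (G : Matrix ι ι ℝ) : Prop where
  posSemidef : G.PosSemidef
  diag : ∀ x, G x x = 7
  off_diag : ∀ x y, x ≠ y → G x y = -5 ∨ G x y = -1 ∨ G x y = 3 ∨ G x y = 7

namespace IsEhlichMatrix

variable {ι κ : Type*} {G : Matrix ι ι ℝ}

theorem submatrix (hG : IsEhlichMatrix G) {f : κ → ι} (hf : Function.Injective f) :
    IsEhlichMatrix (G.submatrix f f) :=
  ⟨hG.posSemidef.submatrix f, fun x => hG.diag (f x), fun _ _ h => hG.off_diag _ _ (hf.ne h)⟩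

theorem apply_comm (hG : IsEhlichMatrix G) (x y : ι) : G x y = G y x := by
  simpa using hG.posSemidef.isHermitian.apply y x

theorem sq_le (hG : IsEhlichMatrix G) (x y : ι) : G x y ^ 2 ≤ 49 := by
  rcases eq_or_ne x y with rfl | h
  · norm_num [hG.diag]
  · rcases hG.off_diag x y h with h | h | h | h <;> norm_num [h]

variable [Fintype ι] [DecidableEq ι]

theorem det_le_pow_card (hG : IsEhlichMatrix G) : G.det ≤ 7 ^ Fintype.card ι := by
  simpa [hG.diag] using hadamard_det_le_prod_diag hG.posSemidef

theorem det_le_of_ne (hG : IsEhlichMatrix G) {x y : ι} (hxy : x ≠ y) :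
    G.det ≤ (49 - G x y ^ 2) * 7 ^ (Fintype.card ι - 2) := by
  have hf : Function.Injective ![x, y] := by
    simp [Function.Injective, Fin.forall_fin_two, hxy, hxy.symm]
  have hpair : (G.submatrix ![x, y] ![x, y]).det = 49 - G x y ^ 2 := by
    simp only [det_fin_two, submatrix_apply, cons_val_zero, cons_val_one, hG.diag,
      hG.apply_comm y x]
    ring
  have hcard : Fintype.card ↥(univ.image ![x, y])ᶜ = Fintype.card ι - 2 := by
    rw [Fintype.card_coe, card_compl, card_image_of_injective _ hf, card_univ, Fintype.card_fin]
  calc G.det ≤ _ := fischer_det_le_det_submatrix_mul hG.posSemidef hf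
    _ ≤ _ := by
      rw [hpair, ← hcard]
      exact mul_le_mul_of_nonneg_left (hG.submatrix Subtype.val_injective).det_le_pow_card
        (sub_nonneg.2 (hG.sq_le x y))

theorem det_le_of_card_eq_four (hG : IsEhlichMatrix G) (hι : Fintype.card ι = 4) :
    G.det ≤ 2048 := by
  by_cases h : ∀ x y, x ≠ y → G x y = -1
  · have hclass : G = classMatrix 4 4 (-1) id := by
      ext x y
      rcases eq_or_ne x y with rfl | hxy
      · norm_num [classMatrix, hG.diag]
      · simp [classMatrix, hxy, h x y hxy]
    rw [hclass, det_classMatrix _ _ four_ne_zero fun k => by positivity]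
    norm_num [hι, filter_eq']
  · push Not at h
    obtain ⟨x, y, hxy, hne⟩ := h
    have hsq : 9 ≤ G x y ^ 2 := by
      rcases hG.off_diag x y hxy with h | h | h | h <;> first | exact absurd h hne | norm_num [h]
    have hdet := hG.det_le_of_ne hxy
    norm_num [hι] at hdet
    linarith

theorem det_le_of_path (hG : IsEhlichMatrix G) (hι : Fintype.card ι = 7) {x y z : ι}
    (hxy : x ≠ y) (hyz : y ≠ z) (hxz : x ≠ z) (h₁ : G x y = 3) (h₂ : G y z = 3) (h₃ : G x z = -1) :
    G.det ≤ 192 * 2048 := by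
  have hf : Function.Injective ![x, y, z] := by
    simp [Function.Injective, Fin.forall_fin_succ, hxy, hyz, hxz, hxy.symm, hyz.symm, hxz.symm]
  have htriple : (G.submatrix ![x, y, z] ![x, y, z]).det = 192 := by
    simp only [det_fin_three, submatrix_apply, Matrix.cons_val, hG.diag, hG.apply_comm y x,
      hG.apply_comm z y, hG.apply_comm z x, h₁, h₂, h₃]
    norm_num
  have hcard : Fintype.card ↥(univ.image ![x, y, z])ᶜ = 4 := by
    rw [Fintype.card_coe, card_compl, card_image_of_injective _ hf, card_univ, Fintype.card_fin, hι]
  calc G.det ≤ _ := fischer_det_le_det_submatrix_mul hG.posSemidef hf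
    _ ≤ _ := by
      rw [htriple]
      gcongr
      exact (hG.submatrix Subtype.val_injective).det_le_of_card_eq_four hcard

theorem det_lt_of_off_diag_equivalence (hG : IsEhlichMatrix G) (hι : Fintype.card ι = 7)
    (hoff : ∀ x y, x ≠ y → G x y = -1 ∨ G x y = 3) (hequiv : Equivalence fun x y => G x y ≠ -1) :
    G.det < 409600 := by
  classical
  let s : Setoid ι := ⟨_, hequiv⟩
  have hclass : G = classMatrix 4 4 (-1) (Quotient.mk s) := by
    ext x y
    rcases eq_or_ne x y with rfl | hxy
    · norm_num [classMatrix, hG.diag]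
    have hmk : Quotient.mk s x = Quotient.mk s y ↔ G x y ≠ -1 := Quotient.eq
    rcases hoff x y hxy with h | h <;> norm_num [classMatrix, hxy, hmk, h]
  have hexp : Real.exp 3 < 20.1 := by
    calc Real.exp 3 = Real.exp 1 ^ 3 := by rw [← Real.exp_nat_mul]; norm_num
      _ < 2.7183 ^ 3 := by gcongr; exact Real.exp_one_lt_d9.trans (by norm_num)
      _ < 20.1 := by norm_num
  have hdet := det_classMatrix_neg_one_le (Quotient.mk s)
  rw [← hclass, hι] at hdet
  norm_num at hdet hexp ⊢
  linarith

theorem det_lt (hG : IsEhlichMatrix G) (hι : Fintype.card ι = 7) : G.det < 409600 := by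
  by_contra! hlarge
  have hoff : ∀ x y, x ≠ y → G x y = -1 ∨ G x y = 3 := fun x y hxy => by
    have hdet := hG.det_le_of_ne hxy
    rcases hG.off_diag x y hxy with h | h | h | h
    · norm_num [hι, h] at hdet; linarith
    · exact .inl h
    · exact .inr h
    · norm_num [hι, h] at hdet; linarith
  refine hlarge.not_gt (hG.det_lt_of_off_diag_equivalence hι hoff ⟨fun x => ?_, fun h => ?_,
    fun {x y z} hxy hyz hxz => ?_⟩)
  · norm_num [hG.diag]
  · rwa [hG.apply_comm]
  · have hne : x ≠ y := by rintro rfl; exact hyz hxz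
    have hne' : y ≠ z := by rintro rfl; exact hxy hxz
    have hne'' : x ≠ z := by rintro rfl; norm_num [hG.diag] at hxz
    have hdet := hG.det_le_of_path hι hne hne' hne'' ((hoff x y hne).resolve_left hxy)
      ((hoff y z hne').resolve_left hyz) hxz
    norm_num at hdet
    linarith

end IsEhlichMatrix

end EhlichMatrix

section SignMatrix

open Matrix

variable {ι : Type*} [Fintype ι]

theorem abs_sum_mul_le_card_of_sign {u v : ι → ℤ} (hu : ∀ i, u i = 1 ∨ u i = -1)
    (hv : ∀ i, v i = 1 ∨ v i = -1) : |∑ i, u i * v i| ≤ Fintype.card ι := by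
  have habs : ∀ i, |u i * v i| = 1 := fun i => by
    rcases hu i with h | h <;> rcases hv i with h' | h' <;> simp [h, h']
  simpa [habs] using abs_sum_le_sum_abs (fun i => u i * v i) univ

theorem sum_mul_modEq_of_sign {u v : ι → ℤ} (hu : ∀ i, u i = 1 ∨ u i = -1)
    (hv : ∀ i, v i = 1 ∨ v i = -1) (hu4 : ∑ i, u i ≡ 1 [ZMOD 4]) (hv4 : ∑ i, v i ≡ 1 [ZMOD 4]) :
    ∑ i, u i * v i ≡ 2 - Fintype.card ι [ZMOD 4] := by
  have hdvd : (4 : ℤ) ∣ ∑ i, (1 - u i) * (1 - v i) := dvd_sum fun i _ => by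
    rcases hu i with h | h <;> rcases hv i with h' | h' <;> simp [h, h']
  have hexpand : ∑ i, (1 - u i) * (1 - v i) =
      Fintype.card ι - ∑ i, u i - ∑ i, v i + ∑ i, u i * v i := by
    simp only [sub_mul, mul_sub, one_mul, mul_one, sum_sub_distrib, sum_const, card_univ,
      nsmul_one]
    ring
  unfold Int.ModEq at *
  omega

theorem exists_sign_mul_sum_modEq_one (hι : Odd (Fintype.card ι)) {u : ι → ℤ}
    (hu : ∀ i, u i = 1 ∨ u i = -1) :
    ∃ s : ℤ, (s = 1 ∨ s = -1) ∧ s * ∑ i, u i ≡ 1 [ZMOD 4] := by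
  have hodd : Odd (∑ i, u i) := by
    have hdvd : (2 : ℤ) ∣ ∑ i, (1 - u i) := dvd_sum fun i _ => by
      rcases hu i with h | h <;> simp [h]
    rw [sum_sub_distrib, sum_const, card_univ, nsmul_one] at hdvd
    obtain ⟨m, hm⟩ := hι
    rw [Int.odd_iff]
    omega
  rw [Int.odd_iff] at hodd
  by_cases h : ∑ i, u i ≡ 1 [ZMOD 4]
  · exact ⟨1, .inl rfl, by rwa [one_mul]⟩
  · refine ⟨-1, .inr rfl, ?_⟩
    unfold Int.ModEq at *
    omega

theorem isEhlichMatrix_mul_transpose (hι : Fintype.card ι = 7) {R : Matrix ι ι ℤ}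
    (hR : ∀ i j, R i j = 1 ∨ R i j = -1) (hsum : ∀ i, ∑ j, R i j ≡ 1 [ZMOD 4]) :
    IsEhlichMatrix (R.map Int.cast * (R.map Int.cast)ᵀ) := by
  set Q : Matrix ι ι ℝ := R.map Int.cast
  have happly : ∀ x y, (Q * Qᵀ) x y = (∑ j, R x j * R y j : ℤ) := fun x y => by
    simp [Q, mul_apply]
  refine ⟨by simpa using posSemidef_self_mul_conjTranspose Q, fun x => ?_, fun x y _ => ?_⟩
  · have hsq : ∀ j, R x j * R x j = 1 := fun j => by rcases hR x j with h | h <;> simp [h]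
    simp [happly, hsq, hι]
  · have hmod := sum_mul_modEq_of_sign (hR x) (hR y) (hsum x) (hsum y)
    have habs := abs_le.1 (abs_sum_mul_le_card_of_sign (hR x) (hR y))
    rw [hι] at hmod habs
    rw [happly]
    norm_cast
    unfold Int.ModEq at hmod
    omega

variable [DecidableEq ι]

theorem det_sq_lt_of_sign (hι : Fintype.card ι = 7) {R : Matrix ι ι ℤ}
    (hR : ∀ i j, R i j = 1 ∨ R i j = -1) : R.det ^ 2 < 640 ^ 2 := by
  choose s hs hsum using fun i => exists_sign_mul_sum_modEq_one (hι ▸ by decide) (hR i)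
  set P : Matrix ι ι ℤ := of fun i j => s i * R i j
  have hP : ∀ i j, P i j = 1 ∨ P i j = -1 := fun i j => by
    rcases hs i with h | h <;> rcases hR i j with h' | h' <;> simp [P, h, h']
  have hdet : P.det ^ 2 = R.det ^ 2 := by
    have hs2 : ∀ i, s i ^ 2 = 1 := fun i => by rcases hs i with h | h <;> simp [h]
    rw [det_mul_column, mul_pow, ← prod_pow, prod_eq_one fun i _ => hs2 i, one_mul]
  have hGram := (isEhlichMatrix_mul_transpose hι hP fun i => by
    simpa [P, mul_sum] using hsum i).det_lt hι
  have hcast : (P.map Int.cast : Matrix ι ι ℝ).det = P.det := (Int.cast_det P).symm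
  rw [det_mul, det_transpose, hcast, ← sq] at hGram
  rw [← hdet]
  norm_num
  exact_mod_cast hGram

theorem det_fromBlocks_one_one_one_sub_two_mul {R : Type*} [CommRing R] (M : Matrix ι ι R) :
    (fromBlocks 1 (of fun _ _ => 1) (of fun _ _ => 1) (of fun i j => 1 - 2 * M i j) :
      Matrix (Unit ⊕ ι) (Unit ⊕ ι) R).det = (-2) ^ Fintype.card ι * M.det := by
  rw [det_fromBlocks_one₁₁, ← det_smul]
  congr 1
  ext i j
  simp [mul_apply]

/-- The largest absolute value of the determinant of a square matrix with entries `0` and `1` whose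
rows and columns are indexed by `ι` (Hadamard's maximal determinant problem). The columns of the
matrix are encoded by the sets of rows in which they have the entry `1`. -/
def maxBinaryDet (ι : Type*) [Fintype ι] [DecidableEq ι] : ℕ :=
  univ.sup fun A : ι → Finset ι =>
    (of fun i j => if i ∈ A j then 1 else 0 : Matrix ι ι ℤ).det.natAbs

theorem natAbs_det_le_maxBinaryDet (A : ι → Finset ι) :
    (of fun i j => if i ∈ A j then 1 else 0 : Matrix ι ι ℤ).det.natAbs ≤ maxBinaryDet ι :=
  le_sup (f := fun A : ι → Finset ι =>
    (of fun i j => if i ∈ A j then 1 else 0 : Matrix ι ι ℤ).det.natAbs) (mem_univ A)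

theorem one_le_maxBinaryDet : 1 ≤ maxBinaryDet ι := by
  refine le_of_eq_of_le ?_ (natAbs_det_le_maxBinaryDet fun j => {j})
  have hone : (of fun i j => if i ∈ ({j} : Finset ι) then 1 else 0 : Matrix ι ι ℤ) = 1 := by
    ext i j
    simp [one_apply]
  rw [hone, det_one, Int.natAbs_one]

theorem maxBinaryDet_le_nine (hι : Fintype.card ι = 6) : maxBinaryDet ι ≤ 9 := by
  refine Finset.sup_le fun A _ => ?_
  set M : Matrix ι ι ℤ := of fun i j => if i ∈ A j then 1 else 0 with hM
  have hsign := det_sq_lt_of_sign (ι := Unit ⊕ ι) (by simp [hι])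
    (R := fromBlocks 1 (of fun _ _ => 1) (of fun _ _ => 1) (of fun i j => 1 - 2 * M i j)) (by
      rintro (i | i) (j | j)
      · simp
      · simp
      · simp
      · by_cases h : i ∈ A j <;> simp [hM, h])
  rw [det_fromBlocks_one_one_one_sub_two_mul, hι, ← Int.natAbs_lt_iff_sq_lt,
    Int.natAbs_mul] at hsign
  norm_num at hsign
  omega

end SignMatrix

section BasicSolutions

variable {C V K : Type*} [Fintype C] [Field K] [LinearOrder K] [IsStrictOrderedRing K]
  [AddCommGroup V] [Module K V]

theorem exists_nonneg_smaller_support (v : C → V) (cost : C → K) {x μ : C → K}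
    (hx : ∀ c, 0 ≤ x c) (hμv : ∑ c, μ c • v c = 0) (hμx : ∀ c, x c = 0 → μ c = 0)
    (hμcost : 0 ≤ ∑ c, μ c * cost c) (hpos : ∃ c, 0 < μ c) :
    ∃ y : C → K, (∀ c, 0 ≤ y c) ∧ ∑ c, y c • v c = ∑ c, x c • v c ∧
      ∑ c, y c * cost c ≤ ∑ c, x c * cost c ∧ #{c | y c ≠ 0} < #{c | x c ≠ 0} := by
  obtain ⟨c₁, hc₁⟩ := hpos
  obtain ⟨c₀, hc₀, hmin⟩ := exists_min_image {c | 0 < μ c} (fun c => x c / μ c)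
    ⟨c₁, by simpa using hc₁⟩
  rw [mem_filter_univ] at hc₀
  set t := x c₀ / μ c₀
  have ht : 0 ≤ t := div_nonneg (hx _) hc₀.le
  refine ⟨fun c => x c - t * μ c, fun c => ?_, ?_, ?_, card_lt_card ?_⟩
  · rcases le_or_gt (μ c) 0 with h | h
    · linarith [mul_nonpos_of_nonneg_of_nonpos ht h, hx c]
    · linarith [(le_div_iff₀ h).1 (hmin c (by simpa using h))]
  · simp only [sub_smul, sum_sub_distrib, mul_smul, ← smul_sum, hμv, smul_zero, sub_zero]
  · simp only [sub_mul, sum_sub_distrib, mul_assoc, ← mul_sum]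
    linarith [mul_nonneg ht hμcost]
  · refine (ssubset_iff_of_subset fun c => ?_).2 ⟨c₀, ?_, ?_⟩
    · simp only [mem_filter_univ]
      exact mt fun h => by rw [h, hμx c h, mul_zero, sub_zero]
    · rw [mem_filter_univ]
      exact mt (hμx c₀) hc₀.ne'
    · simp [t, div_mul_cancel₀ _ hc₀.ne']

theorem exists_sum_smul_eq_zero_of_not_linearIndepOn {v : C → V} {cost x : C → K}
    (hcost : ∀ c, 0 ≤ cost c) (hli : ¬LinearIndepOn K v {c | x c ≠ 0}) :
    ∃ μ : C → K, ∑ c, μ c • v c = 0 ∧ (∀ c, x c = 0 → μ c = 0) ∧ 0 ≤ ∑ c, μ c * cost c ∧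
      ∃ c, 0 < μ c := by
  obtain ⟨μ, hμv, hμx, ⟨c, hc⟩, hμcost⟩ : ∃ μ : C → K, ∑ c, μ c • v c = 0 ∧
      (∀ c, x c = 0 → μ c = 0) ∧ (∃ c, μ c ≠ 0) ∧ 0 ≤ ∑ c, μ c * cost c := by
    rw [← coe_filter_univ, not_linearIndepOn_finset_iff] at hli
    obtain ⟨f, hf, c, hc, hfc⟩ := hli
    rw [mem_filter_univ] at hc
    set μ : C → K := fun c => if x c ≠ 0 then f c else 0
    have hμv : ∑ c, μ c • v c = 0 := by simpa [μ, ite_smul, sum_filter] using hf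
    have hμx : ∀ c, x c = 0 → μ c = 0 := fun c h => by simp [μ, h]
    have hμc : μ c ≠ 0 := by simpa [μ, hc] using hfc
    rcases le_total 0 (∑ c, μ c * cost c) with h | h
    · exact ⟨μ, hμv, hμx, ⟨c, hμc⟩, h⟩
    · exact ⟨-μ, by simpa using hμv, by simpa using hμx, ⟨c, by simpa using hμc⟩, by simpa using h⟩
  by_cases hpos : ∃ c, 0 < μ c
  · exact ⟨μ, hμv, hμx, hμcost, hpos⟩
  push Not at hpos
  have hzero : ∑ c, μ c * cost c = 0 :=
    (sum_nonpos fun c _ => mul_nonpos_of_nonpos_of_nonneg (hpos c) (hcost c)).antisymm hμcost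
  exact ⟨-μ, by simpa using hμv, by simpa using hμx, by simp [hzero],
    c, by simpa using (hpos c).lt_of_ne hc⟩

theorem exists_nonneg_linearIndepOn_support (v : C → V) {cost : C → K} (hcost : ∀ c, 0 ≤ cost c)
    {x : C → K} (hx : ∀ c, 0 ≤ x c) :
    ∃ y : C → K, (∀ c, 0 ≤ y c) ∧ ∑ c, y c • v c = ∑ c, x c • v c ∧
      ∑ c, y c * cost c ≤ ∑ c, x c * cost c ∧ LinearIndepOn K v {c | y c ≠ 0} := by
  induction hn : #{c | x c ≠ 0} using Nat.strong_induction_on generalizing x with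
  | _ n ih =>
    by_cases hli : LinearIndepOn K v {c | x c ≠ 0}
    · exact ⟨x, hx, rfl, le_rfl, hli⟩
    obtain ⟨μ, hμv, hμx, hμcost, hpos⟩ := exists_sum_smul_eq_zero_of_not_linearIndepOn hcost hli
    obtain ⟨y, hy, hyv, hycost, hlt⟩ :=
      exists_nonneg_smaller_support v cost hx hμv hμx hμcost hpos
    obtain ⟨z, hz, hzv, hzcost, hzli⟩ := ih _ (hn ▸ hlt) hy rfl
    exact ⟨z, hz, hzv.trans hyv, hzcost.trans hycost, hzli⟩

end BasicSolutions

section Cramer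

open Matrix

variable {ι C K : Type*} [Fintype ι] [DecidableEq ι]

theorem exists_det_ne_zero_of_linearIndepOn [Field K] {v : C → ι → K}
    (hspan : Submodule.span K (Set.range v) = ⊤) {s : Set C} (hs : LinearIndepOn K v s) :
    ∃ e : ι → C, Function.Injective e ∧ s ⊆ Set.range e ∧
      (of fun i j => v (e j) i : Matrix ι ι K).det ≠ 0 := by
  obtain ⟨t, -, hst, hvt, ht⟩ := exists_linearIndepOn_extension hs (Set.subset_univ _)
  have htop : ⊤ ≤ Submodule.span K (Set.range fun c : t => v c) := by
    rw [← hspan, Submodule.span_le, ← Set.image_univ, ← Set.image_eq_range]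
    exact hvt
  let b := Module.Basis.mk ht htop
  let e : ι ≃ t := (Pi.basisFun K ι).indexEquiv b
  refine ⟨fun i => e i, Subtype.val_injective.comp e.injective, ?_, ?_⟩
  · rw [Set.range_comp' Subtype.val e, e.range_eq_univ, Set.image_univ, Subtype.range_val]
    exact hst
  · exact ((isUnit_iff_isUnit_det _).1
      (linearIndependent_cols_iff_isUnit.1 (ht.comp e e.injective))).ne_zero

theorem intCast_cramer_of_mulVec_eq [CommRing K] {A : Matrix ι ι ℤ} {b : ι → ℤ} {z : ι → K}
    (h : A.map Int.cast *ᵥ z = fun i => (b i : K)) (j : ι) :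
    (A.cramer b j : K) = A.det * z j := by
  have hmap : (A.map Int.cast : Matrix ι ι K).cramer (fun i => (b i : K)) j = A.cramer b j := by
    rw [cramer_apply, cramer_apply, Int.cast_det]
    congr 1
    ext i k
    by_cases hk : k = j <;> simp [hk]
  rw [← hmap, ← h, cramer_eq_adjugate_mulVec, mulVec_mulVec, adjugate_mul, smul_mulVec,
    one_mulVec, Pi.smul_apply, smul_eq_mul, Int.cast_det]

theorem exists_intCast_eq_det_mul [Field K] [CharZero K] [Fintype C] (v : C → ι → ℤ)
    (hspan : Submodule.span K (Set.range fun c i => (v c i : K)) = ⊤) {y : C → K} {b : ι → ℤ}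
    (hy : ∀ i, ∑ c, y c * v c i = b i)
    (hli : LinearIndepOn K (fun c i => (v c i : K)) {c | y c ≠ 0}) :
    ∃ (e : ι → C) (m : C → ℤ), (of fun i j => v (e j) i).det ≠ 0 ∧
      ∀ c, (m c : K) = (of fun i j => v (e j) i).det * y c := by
  classical
  obtain ⟨e, he, hsupp, hdet⟩ := exists_det_ne_zero_of_linearIndepOn hspan hli
  have hzero : ∀ c ∉ Set.range e, y c = 0 := fun c hc => by
    by_contra h
    exact hc (hsupp h)
  set B : Matrix ι ι ℤ := of fun i j => v (e j) i
  have hsolve : B.map Int.cast *ᵥ (y ∘ e) = fun i => (b i : K) := by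
    ext i
    rw [← hy i, ← Fintype.sum_of_injective e he _ (fun c => y c * v c i)
      (fun c hc => by rw [hzero c hc, zero_mul]) fun _ => rfl]
    simp [B, mulVec, dotProduct, mul_comm]
  have hm : ∀ c, ∃ m : ℤ, (m : K) = B.det * y c := fun c => by
    by_cases hc : c ∈ Set.range e
    · obtain ⟨j, rfl⟩ := hc
      exact ⟨B.cramer b j, intCast_cramer_of_mulVec_eq hsolve j⟩
    · exact ⟨0, by simp [hzero c hc]⟩
  choose m hm using hm
  refine ⟨e, m, fun h => hdet ?_, hm⟩
  rw [← Int.cast_zero, ← h, Int.cast_det]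
  rfl

end Cramer

section FractionalCover

open Matrix

variable {ι β K : Type*} [DecidableEq ι] {B : β → Finset ι}

/-- The columns of the covering program `∑ b with i ∈ B b, x b ≥ 1`, `x ≥ 0`, in standard form: the
incidence vectors of the sets `B b`, and the slack columns, which are the negated unit vectors. -/
def coverColumn (B : β → Finset ι) : β ⊕ ι → ι → ℤ :=
  Sum.elim (fun b i => if i ∈ B b then 1 else 0) fun j => Pi.single j (-1)

theorem span_coverColumn [Finite ι] [Field K] (B : β → Finset ι) :
    Submodule.span K (Set.range fun c i => (coverColumn B c i : K)) = ⊤ := by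
  have := Fintype.ofFinite ι
  rw [eq_top_iff, ← (Pi.basisFun K ι).span_eq, Submodule.span_le]
  rintro _ ⟨j, rfl⟩
  have hslack : -(fun i => (coverColumn B (Sum.inr j) i : K)) = Pi.basisFun K ι j := by
    ext i
    by_cases h : i = j <;> simp [coverColumn, Pi.single_apply, h]
  rw [← hslack]
  exact neg_mem (Submodule.subset_span (Set.mem_range_self (Sum.inr j)))

variable [Fintype ι]

theorem natAbs_det_coverColumn_le (B : β → Finset ι) (e : ι → β ⊕ ι) :
    (of fun i j => coverColumn B (e j) i).det.natAbs ≤ maxBinaryDet ι := by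
  let s : β ⊕ ι → ℤ := Sum.elim (fun _ => 1) fun _ => -1
  let A : β ⊕ ι → Finset ι := Sum.elim B fun j => {j}
  have hs : ∀ c, (s c).natAbs = 1 := by rintro (c | c) <;> rfl
  have hA : ∀ c i, s c * coverColumn B c i = if i ∈ A c then 1 else 0 := by
    rintro (b | j) i
    · by_cases h : i ∈ B b <;> simp [s, A, coverColumn, h]
    · by_cases h : i = j <;> simp [s, A, coverColumn, h]
  calc (of fun i j => coverColumn B (e j) i).det.natAbs
      = (of fun i j => s (e j) * (of fun i j => coverColumn B (e j) i) i j).det.natAbs := by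
        have hprod : (∏ j, s (e j)).natAbs = 1 :=
          (map_prod Int.natAbsHom _ _).trans (prod_eq_one fun j _ => hs (e j))
        rw [det_mul_row, Int.natAbs_mul, hprod, one_mul]
    _ ≤ maxBinaryDet ι := by
        simp only [of_apply, hA]
        exact natAbs_det_le_maxBinaryDet fun j => A (e j)

variable [Fintype β] [Field K]

theorem sum_mul_coverColumn (B : β → Finset ι) (y : β ⊕ ι → K) (i : ι) :
    ∑ c, y c * coverColumn B c i = ∑ b with i ∈ B b, y (Sum.inl b) - y (Sum.inr i) := by
  simp [Fintype.sum_sum_type, coverColumn, Pi.single_apply, sum_filter, sub_eq_add_neg]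

variable [LinearOrder K] [IsStrictOrderedRing K]

theorem exists_basic_cover_le {x : β → K} (hx : ∀ b, 0 ≤ x b)
    (hcover : ∀ i, 1 ≤ ∑ b with i ∈ B b, x b) :
    ∃ y : β ⊕ ι → K, (∀ c, 0 ≤ y c) ∧ (∀ i, ∑ c, y c * coverColumn B c i = 1) ∧
      ∑ b, y (Sum.inl b) ≤ ∑ b, x b ∧
      LinearIndepOn K (fun c i => (coverColumn B c i : K)) {c | y c ≠ 0} := by
  obtain ⟨y, hy, hyx, hycost, hli⟩ := exists_nonneg_linearIndepOn_support
    (fun c i => (coverColumn B c i : K)) (cost := Sum.elim 1 0)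
    (by rintro (_ | _) <;> simp)
    (x := Sum.elim x fun i => ∑ b with i ∈ B b, x b - 1)
    (by
      rintro (b | i)
      exacts [hx b, sub_nonneg.2 (hcover i)])
  refine ⟨y, hy, fun i => ?_, by simpa [Fintype.sum_sum_type] using hycost, hli⟩
  have h := congrFun hyx i
  simp only [Finset.sum_apply, Pi.smul_apply, smul_eq_mul] at h
  rw [h, sum_mul_coverColumn, Sum.elim_inr]
  exact sub_sub_cancel _ _

theorem exists_multicover_le_maxBinaryDet {x : β → K} (hx : ∀ b, 0 ≤ x b)
    (hcover : ∀ i, 1 ≤ ∑ b with i ∈ B b, x b) :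
    ∃ d, 1 ≤ d ∧ d ≤ maxBinaryDet ι ∧ ∃ m : β → ℕ, (∀ i, d ≤ ∑ b with i ∈ B b, m b) ∧
      ((∑ b, m b : ℕ) : K) ≤ d * ∑ b, x b := by
  obtain ⟨y, hy, hone, hyx, hli⟩ := exists_basic_cover_le hx hcover
  obtain ⟨e, m, hdet, hm⟩ := exists_intCast_eq_det_mul (coverColumn B) (span_coverColumn B)
    (b := 1) (by simpa using hone) hli
  have hle := natAbs_det_coverColumn_le B e
  set d := (of fun i j => coverColumn B (e j) i).det
  have habs : ∀ c, ((m c).natAbs : K) = d.natAbs * y c := fun c => by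
    rw [Nat.cast_natAbs, Nat.cast_natAbs, Int.cast_abs, Int.cast_abs, hm, abs_mul,
      abs_of_nonneg (hy c)]
  refine ⟨d.natAbs, Int.natAbs_pos.2 hdet, hle, fun b => (m (Sum.inl b)).natAbs, fun i => ?_, ?_⟩
  · have hi := hone i
    rw [sum_mul_coverColumn] at hi
    rw [← Nat.cast_le (α := K), Nat.cast_sum, sum_congr rfl fun b _ => habs (Sum.inl b), ← mul_sum]
    exact le_mul_of_one_le_right (Nat.cast_nonneg _) (by linarith [hy (Sum.inr i)])
  · rw [Nat.cast_sum, sum_congr rfl fun b _ => habs (Sum.inl b), ← mul_sum]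
    gcongr

end FractionalCover

namespace ElectricityInstance

variable {n : ℕ} {I : ElectricityInstance n}

section Packing

theorem Feasible.mono {A B : Finset (Fin n)} (hA : I.Feasible A) (h : B ⊆ A) : I.Feasible B :=
  (sum_le_sum_of_subset_of_nonneg h fun i _ _ => (I.D_pos i).le).trans hA

theorem exists_isPacking_of_cover {β : Type*} [Fintype β] {B : β → Finset (Fin n)}
    (hB : ∀ b, I.Feasible (B b)) {k : ℕ} (hk : ∀ i, k ≤ #{b | i ∈ B b}) :
    ∃ B' : Fin (Fintype.card β) → Finset (Fin n), I.IsPacking k B' := by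
  classical
  choose s hs hcard using fun i => exists_subset_card_eq (hk i)
  let e := Fintype.equivFin β
  refine ⟨fun j => {i | e.symm j ∈ s i}, fun j => (hB (e.symm j)).mono fun i hi => ?_, fun i => ?_⟩
  · rw [mem_filter_univ] at hi
    simpa using hs i hi
  · have hmap : ({j | e.symm j ∈ s i} : Finset _) = (s i).map e.toEmbedding := by
      ext j
      simp [mem_map_equiv]
    simp only [mem_filter_univ, hmap, card_map, hcard]

theorem isPacking_opt (I : ElectricityInstance n) (k : ℕ) :
    ∃ B : Fin (I.opt k) → Finset (Fin n), I.IsPacking k B :=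
  Nat.sInf_mem (I.exists_packing k)

theorem opt_le {k q : ℕ} {B : Fin q → Finset (Fin n)} (hB : I.IsPacking k B) : I.opt k ≤ q :=
  Nat.sInf_le ⟨B, hB⟩

theorem opt_le_sum_of_cover {β : Type*} [Fintype β] {B : β → Finset (Fin n)}
    (hB : ∀ b, I.Feasible (B b)) {k : ℕ} {m : β → ℕ} (hk : ∀ i, k ≤ ∑ b with i ∈ B b, m b) :
    I.opt k ≤ ∑ b, m b := by
  obtain ⟨B', hB'⟩ := exists_isPacking_of_cover (B := fun c : Σ b, Fin (m b) => B c.1)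
    (fun c => hB c.1) (k := k) fun i => (hk i).trans_eq <| by
      rw [card_filter, Fintype.sum_sigma, sum_filter]
      exact sum_congr rfl fun b _ => by by_cases h : i ∈ B b <;> simp [h]
  simpa using opt_le hB'

theorem IsPacking.pos [NeZero n] {k q : ℕ} (hk : 1 ≤ k) {B : Fin q → Finset (Fin n)}
    (hB : I.IsPacking k B) : 0 < q := by
  have h := (hB.2 0).symm.le.trans (card_le_univ _)
  rw [Fintype.card_fin] at h
  exact hk.trans h

theorem opt_pos [NeZero n] (I : ElectricityInstance n) {k : ℕ} (hk : 1 ≤ k) : 0 < I.opt k := by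
  obtain ⟨B, hB⟩ := I.isPacking_opt k
  exact hB.pos hk

theorem IsPacking.mul_sum_le {k q : ℕ} {B : Fin q → Finset (Fin n)} (hB : I.IsPacking k B) :
    k * ∑ i, I.D i ≤ q * I.S := by
  calc k * ∑ i, I.D i = ∑ i, ∑ j with i ∈ B j, I.D i := by
        simp [hB.2, mul_sum]
    _ = ∑ j, ∑ i ∈ B j, I.D i := sum_comm' (by simp)
    _ ≤ ∑ _j : Fin q, I.S := sum_le_sum fun j _ => hB.1 j
    _ = q * I.S := by simp

end Packing

section Schedule

theorem Schedule.length_pos (s : I.Schedule) (l : Fin s.p) : 0 < s.t l.succ - s.t l.castSucc :=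
  sub_pos.2 (s.t_strictMono Fin.castSucc_lt_succ)

theorem Schedule.sum_length (s : I.Schedule) :
    ∑ l : Fin s.p, (s.t l.succ - s.t l.castSucc) = I.T := by
  have h := (Fin.sum_univ_succ s.t).symm.trans (Fin.sum_univ_castSucc s.t)
  rw [s.t_zero, s.t_last] at h
  rw [sum_sub_distrib]
  linarith

theorem Schedule.exists_opt_mul_le (s : I.Schedule) {u : ℝ} (hu : 0 < u)
    (hle : ∀ i, u ≤ s.utility i) :
    ∃ k, 1 ≤ k ∧ k ≤ maxBinaryDet (Fin n) ∧ (I.opt k : ℝ) * u ≤ k * I.T := by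
  obtain ⟨k, hk, hkn, m, hm, hmx⟩ := exists_multicover_le_maxBinaryDet (B := s.A)
    (x := fun l => (s.t l.succ - s.t l.castSucc) / u)
    (fun l => div_nonneg (s.length_pos l).le hu.le) fun i => by
      rw [← sum_div]
      exact (one_le_div hu).2 (hle i)
  refine ⟨k, hk, hkn, ?_⟩
  rw [← sum_div, s.sum_length, ← mul_div_assoc, le_div_iff₀ hu] at hmx
  exact (mul_le_mul_of_nonneg_right (Nat.cast_le.2 (opt_le_sum_of_cover s.feasible hm))
    hu.le).trans hmx

theorem IsPacking.exists_schedule {k q : ℕ} (hq : 0 < q) {B : Fin q → Finset (Fin n)}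
    (hB : I.IsPacking k B) : ∃ s : I.Schedule, ∀ i, s.utility i = (k : ℝ) / q * I.T := by
  have hq' : (0 : ℝ) < q := Nat.cast_pos.2 hq
  refine ⟨⟨q, fun j => j / q * I.T, fun a b hab => ?_, by simp, ?_, B, hB.1⟩, fun i => ?_⟩
  · have hab' : ((a : ℕ) : ℝ) < (b : ℕ) := Nat.cast_lt.2 hab
    have := I.T_pos
    dsimp only
    gcongr
  · simp [hq'.ne']
  · have hlen : ∀ l : Fin q, ((l.succ : ℕ) : ℝ) / q * I.T - ((l.castSucc : ℕ) : ℝ) / q * I.T =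
        1 / q * I.T := fun l => by
      simp only [Fin.val_succ, Fin.val_castSucc]
      push_cast
      ring
    simp only [Schedule.utility, hlen, sum_const, hB.2 i, nsmul_eq_mul]
    ring

variable [NeZero n]

theorem IsPacking.mem_range_iInf_utility {k q : ℕ} (hk : 1 ≤ k) {B : Fin q → Finset (Fin n)}
    (hB : I.IsPacking k B) :
    (k : ℝ) / q * I.T ∈ Set.range fun s : I.Schedule => ⨅ i, s.utility i := by
  obtain ⟨s, hs⟩ := hB.exists_schedule (hB.pos hk)
  exact ⟨s, by simp [hs]⟩

theorem IsSolvedBy.mul_opt_le {k l q : ℕ} (hk : I.IsSolvedBy k) (hl : 1 ≤ l)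
    {B : Fin q → Finset (Fin n)} (hB : I.IsPacking l B) : l * I.opt k ≤ k * q := by
  have h := le_of_mul_le_mul_right (hk.2.2 (hB.mem_range_iInf_utility hl)) I.T_pos
  rw [div_le_div_iff₀ (Nat.cast_pos.2 (hB.pos hl)) (Nat.cast_pos.2 (I.opt_pos hk.1))] at h
  exact_mod_cast h

theorem exists_isSolvedBy_le_maxBinaryDet (I : ElectricityInstance n) :
    ∃ k ≤ maxBinaryDet (Fin n), I.IsSolvedBy k := by
  obtain ⟨k, hk, hmin⟩ := exists_min_image (Icc 1 (maxBinaryDet (Fin n)))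
    (fun k => (I.opt k : ℝ) / k) ⟨1, mem_Icc.2 ⟨le_rfl, one_le_maxBinaryDet⟩⟩
  rw [mem_Icc] at hk
  obtain ⟨B, hB⟩ := I.isPacking_opt k
  refine ⟨k, hk.2, hk.1, hB.mem_range_iInf_utility hk.1, ?_⟩
  rintro _ ⟨s, rfl⟩
  have hT := I.T_pos
  have hopt : (0 : ℝ) < I.opt k := Nat.cast_pos.2 (I.opt_pos hk.1)
  have hk0 : (0 : ℝ) < k := Nat.cast_pos.2 hk.1
  set u := ⨅ i, s.utility i
  change u ≤ _
  rcases le_or_gt u 0 with hu | hu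
  · exact hu.trans (by positivity)
  obtain ⟨m, hm, hmn, hle⟩ :=
    s.exists_opt_mul_le hu fun i => ciInf_le (Set.finite_range _).bddBelow i
  have hm0 : (0 : ℝ) < m := Nat.cast_pos.2 hm
  have hratio : (I.opt k : ℝ) / k * u ≤ I.T :=
    calc (I.opt k : ℝ) / k * u ≤ I.opt m / m * u :=
          mul_le_mul_of_nonneg_right (hmin m (mem_Icc.2 ⟨hm, hmn⟩)) hu.le
      _ ≤ I.T := by rwa [div_mul_eq_mul_div, div_le_iff₀ hm0, mul_comm I.T]
  rw [div_mul_eq_mul_div, div_le_iff₀ hk0] at hratio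
  rw [div_mul_eq_mul_div, le_div_iff₀ hopt]
  linarith

theorem leastK_le_maxBinaryDet (I : ElectricityInstance n) :
    I.leastK ≤ maxBinaryDet (Fin n) := by
  obtain ⟨k, hk, h⟩ := I.exists_isSolvedBy_le_maxBinaryDet
  exact (iInf₂_le k h).trans (Nat.cast_le.2 hk)

end Schedule

section SixHouseholds

theorem leastK_le_nine (I : ElectricityInstance 6) : I.leastK ≤ 9 :=
  I.leastK_le_maxBinaryDet.trans (Nat.cast_le.2 (maxBinaryDet_le_nine (Fintype.card_fin 6)))

/-- A `9`-times bin packing of the demands `4, 2, 5, 3, 2, 1` into `17` full bins of capacity `9`: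
six different bins, with multiplicities `5, 3, 2, 1, 4, 2`. -/
def fullBins (j : Fin 17) : Finset (Fin 6) :=
  (![{2, 3, 5}, {1, 2, 4}, {0, 3, 4}, {0, 2}, {0, 1, 4, 5}, {0, 1, 3}] : Fin 6 → Finset (Fin 6))
    ((![0, 0, 0, 0, 0, 1, 1, 1, 2, 2, 3, 4, 4, 4, 4, 5, 5] : Fin 17 → Fin 6) j)

variable {I : ElectricityInstance 6}

theorem sum_fullBins (hS : I.S = 9) (hD : I.D = ![4, 2, 5, 3, 2, 1]) (j : Fin 17) :
    ∑ i ∈ fullBins j, I.D i = I.S := by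
  unfold fullBins
  generalize (![0, 0, 0, 0, 0, 1, 1, 1, 2, 2, 3, 4, 4, 4, 4, 5, 5] : Fin 17 → Fin 6) j = a
  rw [hS, hD]
  fin_cases a <;> simp <;> norm_num

theorem isPacking_fullBins (hS : I.S = 9) (hD : I.D = ![4, 2, 5, 3, 2, 1]) :
    I.IsPacking 9 fullBins :=
  ⟨fun j => (sum_fullBins hS hD j).le, by decide⟩

theorem seventeen_mul_le_nine_mul_opt (hS : I.S = 9) (hD : I.D = ![4, 2, 5, 3, 2, 1]) (k : ℕ) :
    17 * k ≤ 9 * I.opt k := by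
  obtain ⟨B, hB⟩ := I.isPacking_opt k
  have htotal : ∑ i, I.D i = 17 := by norm_num [hD, Fin.sum_univ_succ]
  have h := hB.mul_sum_le
  rw [hS, htotal] at h
  rw [mul_comm 17, mul_comm 9]
  exact_mod_cast h

theorem opt_nine_eq (hS : I.S = 9) (hD : I.D = ![4, 2, 5, 3, 2, 1]) : I.opt 9 = 17 := by
  have hle := opt_le (isPacking_fullBins hS hD)
  have hge := seventeen_mul_le_nine_mul_opt hS hD 9
  omega

theorem leastK_eq_nine (hS : I.S = 9) (hD : I.D = ![4, 2, 5, 3, 2, 1]) : I.leastK = 9 := by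
  refine le_antisymm I.leastK_le_nine (le_iInf₂ fun k hk => ?_)
  have hle := seventeen_mul_le_nine_mul_opt hS hD k
  have hge := hk.mul_opt_le (by norm_num) (isPacking_fullBins hS hD)
  have hdvd : 9 ∣ k := by omega
  exact_mod_cast Nat.le_of_dvd hk.1 hdvd

theorem exists_S_eq_and_D_eq :
    ∃ I : ElectricityInstance 6, I.S = 9 ∧ I.D = ![4, 2, 5, 3, 2, 1] :=
  ⟨⟨9, ![4, 2, 5, 3, 2, 1], 1, by norm_num, by intro i; fin_cases i <;> simp,
    by intro i; fin_cases i <;> simp <;> norm_num, one_pos⟩, rfl, rfl⟩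

end SixHouseholds

end ElectricityInstance

theorem mainTheorem7 :
    maxLeastK 6 = 9 ∧
      ∀ I : ElectricityInstance 6, I.S = 9 → I.D = ![4, 2, 5, 3, 2, 1] →
        I.leastK = 9 ∧ I.opt 9 = 17 ∧
          ∃ B : Fin 17 → Finset (Fin 6), I.IsPacking 9 B ∧ ∀ j, ∑ i ∈ B j, I.D i = I.S := by
  refine ⟨le_antisymm (iSup_le fun I => I.leastK_le_nine) ?_, fun I hS hD =>
    ⟨ElectricityInstance.leastK_eq_nine hS hD, ElectricityInstance.opt_nine_eq hS hD,
      ElectricityInstance.fullBins, ElectricityInstance.isPacking_fullBins hS hD,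
      ElectricityInstance.sum_fullBins hS hD⟩⟩
  obtain ⟨I, hS, hD⟩ := ElectricityInstance.exists_S_eq_and_D_eq
  exact (ElectricityInstance.leastK_eq_nine hS hD).ge.trans
    (le_iSup ElectricityInstance.leastK I)
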